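/- Let $\overline\rho>0$, $f\in C^1[0,\overline\rho]$ with $f(0)=0$, $h=f'$, $c\in\mathbb R$. For a source term $g\in C[0,\overline\rho]$ consider $$\rho_t+f(\rho)_x=(D(\rho)\rho_x)_x+g(\rho).\qquad (E_g)$$ A traveling-wave profile of $(E_g)$ with speed $c$ on an open interval $I$ is a continuous function $\varphi:I\to[0,\overline\rho]$, differentiable a.e., with $D(\varphi)\varphi'\in L^1_{\rm loc}(I)$ and $$\int_I\{(D(\varphi)\varphi'-f(\varphi)+c\varphi)\psi'-g(\varphi)\psi\}\,d\xi=0\quad\text{for all }\psi\in C_0^\infty(I).$$ It is classical on an open set $U\subseteq I$ if it is differentiable in $U$, $D(\varphi)\varphi'$ is absolutely continuous on the compact intervals contained in $U$, and $(D(\varphi)\varphi')'+(c-h(\varphi))\varphi'+g(\varphi)=0$ a.e. in $U$. All profiles below are assumed to be classical or sharp, i.e. classical on $I\setminus S$ for some finite (possibly empty) set $S\subseteq I$ at each point of which $\varphi$ is not differentiable and takes a value where $g$ vanishes. A wavefront profile connecting $\overline\rho$ with $0$ is a profile on $I=\mathbb R$ with $\varphi(-\infty)=\overline\rho$, $\varphi(+\infty)=0$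 and $g(\overline\rho)=g(0)=0$. A semi-wavefront profile from $\overline\rho$ is a monotone (in the weak sense), non-constant profile on some half-line $I=(-\infty,\varpi)$, $\varpi\in\mathbb R$, with $\varphi(-\infty)=\overline\rho$ and $g(\overline\rho)=0$. Let $g_0,g_1,g_2,\dots\in C[0,\overline\rho]$ be such that - $g_0>0$ in $(0,\overline\rho)$, $g_0(0)=g_0(\overline\rho)=0$ and $\limsup_{\rho\to0^+}D(\rho)g_0(\rho)/\rho<+\infty$; - for $n\ge1$, $g_n>0$ in $[0,\overline\rho)$ and $g_n(\overline\rho)=0$; - $(g_n)_{n\ge1}$ is decreasing in $n$ (in the weak sense) on $[0,\overline\rho]$, and $g_n\to g_0$ uniformly on $[0,\overline\rho]$. Assume that either $D\in C^1[0,\overline\rho]$ and $D>0$ in $(0,\overline\rho)$; or $D\in C[0,\overline\rho]\cap C^1[0,\overline\rho)$, $D>0$ in $(0,\overline\rho)$, $D(\overline\rho)=0$, the derivative of $D$ at $\overline\rho$ is $-\infty$, and for every $n\ge0$ the limit of $D(\rho)g_n(\rho)/(\rho-\overline\rho)$ as $\rho\to\overline\rho^-$ exists in $(-\infty,0]$.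 Let $\varphi_0$ be a wavefront profile of $(E_{g_0})$ connecting $\overline\rho$ with $0$ and, for $n\ge1$, let $\varphi_n$ be a semi-wavefront profile of $(E_{g_n})$ from $\overline\rho$, defined on $(-\infty,\varpi_n)$ with $\varpi_n>0$; all of them have the same speed $c$ and satisfy $\varphi_n(0)=\overline\rho/2$ for $n\ge0$. (1) If $n\ge1$ and $g_0<g_n$ on $(0,\overline\rho)$, then for every $\xi<0$ we have $\varphi_0(\xi)<\varphi_n(\xi)$ if $\varphi_0(\xi)<\overline\rho$, and $\varphi_n(\xi)=\overline\rho$ if $\varphi_0(\xi)=\overline\rho$; moreover $\varphi_0(\xi)>\varphi_n(\xi)$ for every $\xi\in(0,\varpi_n)$. (2) If $(g_n)_{n\ge1}$ is strictly decreasing in $n$ on $(0,\overline\rho)$, then $(\varphi_n)_{n\ge1}$ is decreasing in $n$ on $(-\infty,0)$ and increasing in $n$ on every interval $[0,a]$ with $a<\varpi_n$ for all $n\ge1$. More precisely, let $1\le m<n$. If $\xi<0$, then $\varphi_n(\xi)\le\varphi_m(\xi)$, with strict inequality if $\varphi_n(\xi)<\overline\rho$. If $0\le\xi\le a$, then $\varphi_m(\xi)\le\varphi_n(\xi)$,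 with strict inequality if $\xi>0$. -/

import Mathlib

open Set Filter Topology MeasureTheory
open scoped ContDiff

/-- The flux term `ξ ↦ D(φ(ξ)) φ'(ξ)`. It is only used on open sets, so that `deriv` at the points
of the set depends only on the values of `φ` there. -/
noncomputable def diffusionFlux (D φ : ℝ → ℝ) : ℝ → ℝ := fun ξ => D (φ ξ) * deriv φ ξ

/-- `φ : I → [0, R]` is the profile of a traveling-wave solution `ρ(x,t) = φ(x - c t)` of
`ρ_t + f(ρ)_x = (D(ρ) ρ_x)_x + g(ρ)` on the open interval `I`, with speed `c`:
`φ` is continuous, differentiable a.e., `D(φ) φ'` is locally integrable, and the equation holds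
in the weak sense against all test functions in `C₀^∞(I)`. -/
structure IsTravelingWaveProfile (R : ℝ) (D f g : ℝ → ℝ) (c : ℝ) (I : Set ℝ) (φ : ℝ → ℝ) :
    Prop where
  isOpen : IsOpen I
  ordConnected : I.OrdConnected
  mapsTo : MapsTo φ I (Icc 0 R)
  continuousOn : ContinuousOn φ I
  ae_differentiable : ∀ᵐ ξ ∂(volume.restrict I), DifferentiableAt ℝ φ ξ
  locallyIntegrableOn : LocallyIntegrableOn (diffusionFlux D φ) I volume
  weak : ∀ ψ : ℝ → ℝ, ContDiff ℝ ∞ ψ → HasCompactSupport ψ → tsupport ψ ⊆ I →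
    ∫ ξ in I, ((diffusionFlux D φ ξ - f (φ ξ) + c * φ ξ) * deriv ψ ξ - g (φ ξ) * ψ ξ) = 0

/-- `φ` is classical on the open set `U`: it is differentiable in `U`, `D(φ) φ'` is absolutely
continuous (on compact intervals contained in `U`), and
`(D(φ) φ')' + (c - h(φ)) φ' + g(φ) = 0` a.e. in `U`, where `h = f'` on `[0, R]`. -/
structure IsClassicalOn (R : ℝ) (D f g : ℝ → ℝ) (c : ℝ) (U : Set ℝ) (φ : ℝ → ℝ) : Prop where
  differentiableAt : ∀ ξ ∈ U, DifferentiableAt ℝ φ ξ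
  absolutelyContinuous : ∀ a b : ℝ, a ≤ b → Icc a b ⊆ U →
    AbsolutelyContinuousOnInterval (diffusionFlux D φ) a b
  ode : ∀ᵐ ξ ∂(volume.restrict U),
    deriv (diffusionFlux D φ) ξ + (c - derivWithin f (Icc 0 R) (φ ξ)) * deriv φ ξ + g (φ ξ) = 0

/-- `φ` is classical or sharp in `I`: it is classical off a finite set `S` of points, at which `φ`
is not differentiable and takes a value where `g` vanishes. `S = ∅` is the classical case,
`S = {ξ₀}` the case of a profile which is sharp at `φ ξ₀`; a wavefront profile may also be sharp at
both of its end states, and then `S` has two points. -/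
def IsClassicalOrSharp (R : ℝ) (D f g : ℝ → ℝ) (c : ℝ) (I : Set ℝ) (φ : ℝ → ℝ) : Prop :=
  ∃ S : Set ℝ, S.Finite ∧ S ⊆ I ∧ (∀ ξ ∈ S, g (φ ξ) = 0 ∧ ¬ DifferentiableAt ℝ φ ξ) ∧
    IsClassicalOn R D f g c (I \ S) φ

/-- `φ` is the profile of a (classical or sharp) wavefront solution connecting `l` (at `-∞`) with
`r` (at `+∞`). -/
structure IsWavefrontProfile (R : ℝ) (D f g : ℝ → ℝ) (c l r : ℝ) (φ : ℝ → ℝ) : Prop where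
  travelingWave : IsTravelingWaveProfile R D f g c univ φ
  classicalOrSharp : IsClassicalOrSharp R D f g c univ φ
  zero_left : g l = 0
  zero_right : g r = 0
  tendsto_left : Tendsto φ atBot (𝓝 l)
  tendsto_right : Tendsto φ atTop (𝓝 r)

/-- `φ`, defined in `(-∞, w)`, is the profile of a (classical or sharp) semi-wavefront solution
from `l`. Only the values of `φ` in `(-∞, w)` matter. -/
structure IsSemiWavefrontProfileFrom (R : ℝ) (D f g : ℝ → ℝ) (c l w : ℝ) (φ : ℝ → ℝ) :
    Prop where
  travelingWave : IsTravelingWaveProfile R D f g c (Iio w) φ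
  classicalOrSharp : IsClassicalOrSharp R D f g c (Iio w) φ
  mem : l ∈ Icc 0 R
  zero : g l = 0
  monotonic : MonotoneOn φ (Iio w) ∨ AntitoneOn φ (Iio w)
  nonconstant : ¬ ∃ k : ℝ, ∀ ξ ∈ Iio w, φ ξ = k
  tendsto_left : Tendsto φ atBot (𝓝 l)

/-- `D ∈ C¹[0, R]` and `D > 0` in `(0, R)`. -/
structure DiffusivityHat (R : ℝ) (D : ℝ → ℝ) : Prop where
  contDiffOn : ContDiffOn ℝ 1 D (Icc 0 R)
  pos : ∀ ρ ∈ Ioo 0 R, 0 < D ρ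

/-- `D ∈ C[0, R] ∩ C¹[0, R)`, `D(R) = 0`, `D > 0` in `(0, R)`, the derivative of `D` at `R`
is `-∞`, and `D(ρ) g(ρ) / (ρ - R)` has a limit in `(-∞, 0]` as `ρ → R⁻`. -/
structure DiffusivityTilde (R : ℝ) (D g : ℝ → ℝ) : Prop where
  continuousOn : ContinuousOn D (Icc 0 R)
  contDiffOn : ContDiffOn ℝ 1 D (Ico 0 R)
  zero : D R = 0
  pos : ∀ ρ ∈ Ioo 0 R, 0 < D ρ
  deriv_right : Tendsto (fun ρ => (D ρ - D R) / (ρ - R)) (𝓝[<] R) atBot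
  limit : ∃ l : ℝ, l ≤ 0 ∧ Tendsto (fun ρ => D ρ * g ρ / (ρ - R)) (𝓝[<] R) (𝓝 l)

/-- `g ∈ C[0, R]`, `g > 0` in `[0, R)` and `g(R) = 0`. -/
structure SourcePositive (R : ℝ) (g : ℝ → ℝ) : Prop where
  continuousOn : ContinuousOn g (Icc 0 R)
  pos : ∀ ρ ∈ Ico 0 R, 0 < g ρ
  zero : g R = 0

/-- `g ∈ C[0, R]`, `g > 0` in `(0, R)`, `g(0) = g(R) = 0` and
`limsup_{ρ → 0⁺} D(ρ) g(ρ) / ρ < +∞` (the limsup taken in the extended reals). -/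
structure SourceMonostable (R : ℝ) (D g : ℝ → ℝ) : Prop where
  continuousOn : ContinuousOn g (Icc 0 R)
  pos : ∀ ρ ∈ Ioo 0 R, 0 < g ρ
  zero_left : g 0 = 0
  zero_right : g R = 0
  limsup_lt : limsup (fun ρ : ℝ => ((D ρ * g ρ / ρ : ℝ) : EReal)) (𝓝[>] 0) < ⊤

/-! Integrating the equation once gives `D(φ) φ' = W + f(φ) - c φ` with `W' = -g(φ)`, and `W` is
differentiable even across sharp points. As `g ≥ 0`, `W` decreases, and its supremum is `c R - f R`,
the value at which the flux vanishes at the state `R`.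

Where the value lies in `(0, R)` the flux is negative and `φ` is strictly decreasing, so position
becomes a function `ξ(ρ)` of the value. With `w(ρ) = W(ξ(ρ))` and `z = w + f - c ρ < 0`, the problem
turns into the first-order system `ξ' = D / z`, `w' = -g D / z`.

Let `g₁ > g₂`. If `w₁ ≥ w₂` at some value, then `|z₁| ≤ |z₂|` there, so `w₁ - w₂` increases from
that value on and stays away from `0` as `ρ → R`. This is impossible, since `w₁ ≤ c R - f R` while
`w₂` comes arbitrarily close to that bound. Hence `w₁ < w₂` (`flux_inv_lt`), so `ξ₁ - ξ₂` is
strictly increasing (`inv_sub_inv_strictMonoOn`). It vanishes at `R / 2` by the normalization, and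
its sign on either side orders the profiles.

Monotonicity of the wavefront is not assumed: it follows from the absence of interior local minima
and the vanishing of the flux at extreme values (`antitone_of_tendsto`). -/

/-! ### Functions with vanishing weak derivative -/

theorem exists_Icc_superset_of_isCompact {I K : Set ℝ} (hI : I.OrdConnected) (hK : IsCompact K)
    (hne : K.Nonempty) (hKI : K ⊆ I) : ∃ a b, K ⊆ Icc a b ∧ Icc a b ⊆ I :=
  ⟨sInf K, sSup K, fun _ hx => ⟨csInf_le hK.bddBelow hx, le_csSup hK.bddAbove hx⟩,
    hI.out (hKI (hK.sInf_mem hne)) (hKI (hK.sSup_mem hne))⟩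

theorem integrable_mul_of_tsupport_subset {I : Set ℝ} {u θ : ℝ → ℝ}
    (hu : LocallyIntegrableOn u I volume) (hθ : Continuous θ) (hc : HasCompactSupport θ)
    (hs : tsupport θ ⊆ I) : Integrable (fun x => u x * θ x) := by
  have h1 : IntegrableOn (fun x => u x * θ x) (tsupport θ) :=
    (hu.integrableOn_compact_subset hs hc).mul_continuousOn hθ.continuousOn hc
  refine (integrableOn_iff_integrable_of_support_subset ?_).1 h1
  intro x hx
  exact subset_tsupport θ (right_ne_zero_of_mul hx)

/-- A smooth function of mean zero supported in `[a, b]` has a smooth primitive supported in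
`[a, b]`. -/
theorem exists_contDiff_primitive {a b : ℝ} {θ : ℝ → ℝ} (hθ : ContDiff ℝ ∞ θ)
    (hs : tsupport θ ⊆ Icc a b) (h0 : ∫ x, θ x = 0) :
    ∃ ψ : ℝ → ℝ, ContDiff ℝ ∞ ψ ∧ HasCompactSupport ψ ∧ tsupport ψ ⊆ Icc a b ∧ deriv ψ = θ := by
  have hz : ∀ x, x ∉ Icc a b → θ x = 0 := fun x hx =>
    image_eq_zero_of_notMem_tsupport fun h => hx (hs h)
  have hint : Integrable θ := hθ.continuous.integrable_of_hasCompactSupport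
    (isCompact_Icc.of_isClosed_subset (isClosed_tsupport θ) hs)
  have hder : ∀ x, HasDerivAt (fun x => ∫ t in Iic x, θ t) (θ x) x := by
    intro x
    have h1 : (fun x => ∫ t in Iic x, θ t) =
        fun x => (∫ t in Iic 0, θ t) + ∫ t in (0 : ℝ)..x, θ t := by
      funext y
      rw [← intervalIntegral.integral_Iic_sub_Iic hint.integrableOn hint.integrableOn]
      ring
    rw [h1]
    exact (intervalIntegral.integral_hasDerivAt_right hint.intervalIntegrable
      (hθ.continuous.stronglyMeasurableAtFilter _ _) hθ.continuous.continuousAt).const_add _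
  have hd : deriv (fun x => ∫ t in Iic x, θ t) = θ := funext fun x => (hder x).deriv
  have hts : tsupport (fun x => ∫ t in Iic x, θ t) ⊆ Icc a b := by
    refine closure_minimal ?_ isClosed_Icc
    intro x hx
    by_contra hn
    apply hx
    rcases lt_or_ge x a with h | h
    · exact setIntegral_eq_zero_of_forall_eq_zero fun t ht =>
        hz t fun h' => (lt_of_le_of_lt ht h).not_ge h'.1
    · have hb : b < x := by
        by_contra h'
        exact hn ⟨h, not_lt.1 h'⟩
      change ∫ t in Iic x, θ t = 0
      rw [setIntegral_eq_integral_of_forall_compl_eq_zero, h0]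
      intro t ht
      exact hz t fun h' => (hb.trans (not_le.1 ht)).not_ge h'.2
  refine ⟨_, contDiff_infty_iff_deriv.2 ⟨fun x => (hder x).differentiableAt, ?_⟩,
    isCompact_Icc.of_isClosed_subset (isClosed_tsupport _) hts, hts, hd⟩
  rw [hd]
  exact hθ

/-- The lemma of du Bois-Reymond: a locally integrable function with vanishing weak derivative on
an open interval is a.e. constant there. -/
theorem ae_eq_const_of_forall_integral_mul_deriv_eq_zero {I : Set ℝ} {u : ℝ → ℝ} (hI : IsOpen I)
    (hI' : I.OrdConnected) (hne : I.Nonempty) (hu : LocallyIntegrableOn u I volume)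
    (h : ∀ ψ : ℝ → ℝ, ContDiff ℝ ∞ ψ → HasCompactSupport ψ → tsupport ψ ⊆ I →
      ∫ x, u x * deriv ψ x = 0) :
    ∃ C : ℝ, ∀ᵐ x ∂volume, x ∈ I → u x = C := by
  obtain ⟨p, hp⟩ := hne
  obtain ⟨ε, hε, hεI⟩ := Metric.nhds_basis_closedBall.mem_iff.1 (hI.mem_nhds hp)
  let B : ContDiffBump p := ⟨ε / 2, ε, by positivity, by linarith⟩
  set η : ℝ → ℝ := B.normed volume with hηdef
  have hηs : ContDiff ℝ ∞ η := B.contDiff_normed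
  have hηc : HasCompactSupport η := B.hasCompactSupport_normed
  have hηI : tsupport η ⊆ I := by rw [hηdef, B.tsupport_normed_eq]; exact hεI
  have hη1 : ∫ x, η x = 1 := B.integral_normed
  have hηint : Integrable η := hηs.continuous.integrable_of_hasCompactSupport hηc
  refine ⟨∫ x, u x * η x, ?_⟩
  set C := ∫ x, u x * η x with hC
  have hloc : LocallyIntegrableOn (fun x => u x - C) I volume :=
    hu.sub ((locallyIntegrable_const C).locallyIntegrableOn I)
  have key := hI.ae_eq_zero_of_integral_contDiff_smul_eq_zero hloc ?_
  · filter_upwards [key] with x hx hxI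
    exact sub_eq_zero.1 (hx hxI)
  intro θ hθ hθc hθI
  have hθint : Integrable θ := hθ.continuous.integrable_of_hasCompactSupport hθc
  obtain ⟨a, b, hKab, habI⟩ := exists_Icc_superset_of_isCompact hI'
    (hθc.isCompact.union hηc.isCompact)
    ⟨p, Or.inr (by rw [hηdef, B.tsupport_normed_eq]; exact Metric.mem_closedBall_self hε.le)⟩
    (union_subset hθI hηI)
  set m := ∫ x, θ x with hm
  -- Since `η` has mass one, `θ - m η` has mean zero, hence is the derivative of an admissible test
  -- function.
  have hts : tsupport (fun x => θ x - m * η x) ⊆ Icc a b := by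
    refine closure_minimal ?_ isClosed_Icc
    intro x hx
    by_contra hn
    have h1 : θ x = 0 := image_eq_zero_of_notMem_tsupport fun h' => hn (hKab (Or.inl h'))
    have h2 : η x = 0 := image_eq_zero_of_notMem_tsupport fun h' => hn (hKab (Or.inr h'))
    exact hx (by simp [h1, h2])
  obtain ⟨ψ, hψ, hψc, hψs, hψd⟩ := exists_contDiff_primitive (hθ.sub (contDiff_const.mul hηs)) hts
    (by rw [integral_sub hθint (hηint.const_mul m), integral_const_mul, hη1]; simp [hm])
  have h3 := h ψ hψ hψc (hψs.trans habI)
  have hi1 := integrable_mul_of_tsupport_subset hu hθ.continuous hθc hθI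
  have hi2 := integrable_mul_of_tsupport_subset hu hηs.continuous hηc hηI
  have h4 : ∫ x, u x * deriv ψ x = (∫ x, u x * θ x) - m * C := by
    rw [hψd, hC, ← integral_const_mul, ← integral_sub hi1 (hi2.const_mul m)]
    congr 1
    funext x
    ring
  have h5 : ∫ x, θ x • (u x - C) = (∫ x, u x * θ x) - m * C := by
    rw [mul_comm m, hm, ← integral_const_mul, ← integral_sub hi1 (hθint.const_mul C)]
    congr 1
    funext x
    simp only [smul_eq_mul]
    ring
  rw [h5, ← h4, h3]

/-! ### First integral of the profile equation -/

/-- The integrated form of the profile equation on the open interval `I`: the flux `D(φ) φ'` equals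
`W + f(φ) - c φ` off a finite set of points where `g(φ) = 0`, with `W' = - g(φ)`. -/
structure FluxBalance (R : ℝ) (D f g : ℝ → ℝ) (c : ℝ) (I : Set ℝ) (φ W : ℝ → ℝ) (S : Set ℝ) :
    Prop where
  isOpen : IsOpen I
  ordConnected : I.OrdConnected
  mapsTo : MapsTo φ I (Icc 0 R)
  continuousOn : ContinuousOn φ I
  hasDerivAt : ∀ ξ ∈ I, HasDerivAt W (-g (φ ξ)) ξ
  finite : S.Finite
  source_eq_zero : ∀ ξ ∈ S, g (φ ξ) = 0
  differentiableAt : ∀ ξ ∈ I, ξ ∉ S → DifferentiableAt ℝ φ ξ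
  flux_eq : ∀ ξ ∈ I, ξ ∉ S → D (φ ξ) * deriv φ ξ = W ξ + f (φ ξ) - c * φ ξ

theorem IsTravelingWaveProfile.exists_fluxBalance {R : ℝ} {D f g : ℝ → ℝ} {c : ℝ} {I : Set ℝ}
    {φ : ℝ → ℝ} (hφ : IsTravelingWaveProfile R D f g c I φ)
    (hcs : IsClassicalOrSharp R D f g c I φ) (h0 : (0 : ℝ) ∈ I)
    (hf : ContinuousOn f (Icc 0 R)) (hg : ContinuousOn g (Icc 0 R)) :
    ∃ W S, FluxBalance R D f g c I φ W S := by
  obtain ⟨S, hSf, hSI, hS, hcl⟩ := hcs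
  have hgφ : ContinuousOn (fun ξ => g (φ ξ)) I := hg.comp hφ.continuousOn hφ.mapsTo
  have hfφ : ContinuousOn (fun ξ => f (φ ξ)) I := hf.comp hφ.continuousOn hφ.mapsTo
  set G : ℝ → ℝ := fun ξ => ∫ t in (0 : ℝ)..ξ, g (φ t) with hGdef
  have hG : ∀ ξ ∈ I, HasDerivAt G (g (φ ξ)) ξ := by
    intro ξ hξ
    have hsub : uIcc 0 ξ ⊆ I := hφ.ordConnected.uIcc_subset h0 hξ
    exact intervalIntegral.integral_hasDerivAt_right (hgφ.mono hsub).intervalIntegrable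
      (hgφ.stronglyMeasurableAtFilter hφ.isOpen ξ hξ) (hgφ.continuousAt (hφ.isOpen.mem_nhds hξ))
  have hGc : ContinuousOn G I := fun ξ hξ => (hG ξ hξ).continuousAt.continuousWithinAt
  have hmeas : MeasurableSet I := hφ.isOpen.measurableSet
  have hcont : ContinuousOn (fun ξ => -f (φ ξ) + c * φ ξ) I :=
    hfφ.neg.add (continuousOn_const.mul hφ.continuousOn)
  have hl1 : LocallyIntegrableOn (fun ξ => diffusionFlux D φ ξ + (-f (φ ξ) + c * φ ξ)) I volume :=
    hφ.locallyIntegrableOn.add (hcont.locallyIntegrableOn hmeas)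
  have hl : LocallyIntegrableOn
      (fun ξ => (diffusionFlux D φ ξ + (-f (φ ξ) + c * φ ξ)) + G ξ) I volume :=
    hl1.add (hGc.locallyIntegrableOn hmeas)
  obtain ⟨C, hC⟩ := ae_eq_const_of_forall_integral_mul_deriv_eq_zero hφ.isOpen hφ.ordConnected
    ⟨0, h0⟩ hl (by
      intro ψ hψ hψc hψI
      have hψ' : Continuous (deriv ψ) := hψ.continuous_deriv (by simp)
      have hψ'I : tsupport (deriv ψ) ⊆ I := (tsupport_deriv_subset).trans hψI
      have i1 := integrable_mul_of_tsupport_subset hl1 hψ' hψc.deriv hψ'I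
      have i2 := integrable_mul_of_tsupport_subset (hGc.locallyIntegrableOn hmeas) hψ'
        hψc.deriv hψ'I
      have i3 := integrable_mul_of_tsupport_subset (hgφ.locallyIntegrableOn hmeas)
        hψ.continuous hψc hψI
      have i4 := integrable_mul_of_tsupport_subset (hGc.locallyIntegrableOn hmeas)
        hψ.continuous hψc hψI
      have e1 : ∫ ξ, ((diffusionFlux D φ ξ + (-f (φ ξ) + c * φ ξ)) * deriv ψ ξ
          - g (φ ξ) * ψ ξ) = 0 := by
        rw [← hφ.weak ψ hψ hψc hψI, eq_comm, setIntegral_eq_integral_of_forall_compl_eq_zero]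
        · congr 1
          funext x
          ring
        · intro x hx
          have a1 : ψ x = 0 := image_eq_zero_of_notMem_tsupport fun h' => hx (hψI h')
          have a2 : deriv ψ x = 0 := image_eq_zero_of_notMem_tsupport fun h' => hx (hψ'I h')
          simp [a1, a2]
      -- Integration by parts: the integrand is `(G ψ)'`. This moves the source term onto `ψ'`, so
      -- that the weak equation becomes a vanishing weak derivative.
      have e2 : ∫ ξ, (g (φ ξ) * ψ ξ + G ξ * deriv ψ ξ) = 0 := by
        refine integral_eq_zero_of_hasDerivAt_of_integrable (f := fun ξ => G ξ * ψ ξ) ?_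
          (i3.add i2) i4
        intro ξ
        by_cases hξ : ξ ∈ I
        · exact (hG ξ hξ).mul (hψ.differentiable (by simp) ξ).hasDerivAt
        · have hn : ξ ∉ tsupport ψ := fun h' => hξ (hψI h')
          have a1 : ψ ξ = 0 := image_eq_zero_of_notMem_tsupport hn
          have a2 : deriv ψ ξ = 0 := image_eq_zero_of_notMem_tsupport fun h' => hξ (hψ'I h')
          rw [a1, a2, mul_zero, mul_zero, add_zero]
          refine (hasDerivAt_const ξ (0 : ℝ)).congr_of_eventuallyEq ?_
          filter_upwards [(isClosed_tsupport ψ).isOpen_compl.mem_nhds hn] with y hy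
          rw [image_eq_zero_of_notMem_tsupport hy, mul_zero]
      have e3 := integral_add (i1.sub i3) (i3.add i2)
      simp only [Pi.sub_apply, Pi.add_apply] at e3
      rw [e1, e2, add_zero] at e3
      rw [← e3]
      congr 1
      funext x
      ring)
  have hopen : IsOpen (I \ S) := hφ.isOpen.sdiff hSf.isClosed
  have hflux : ContinuousOn (diffusionFlux D φ) (I \ S) := by
    intro ξ hξ
    obtain ⟨ε, hε, hball⟩ := Metric.nhds_basis_closedBall.mem_iff.1 (hopen.mem_nhds hξ)
    rw [Real.closedBall_eq_Icc] at hball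
    have hac := (hcl.absolutelyContinuous (ξ - ε) (ξ + ε) (by linarith) hball).continuousOn
    rw [uIcc_of_le (by linarith)] at hac
    exact (hac.continuousAt (Icc_mem_nhds (by linarith) (by linarith))).continuousWithinAt
  -- Both sides are continuous off `S`, so the a.e. identity holds at every point there.
  have heq : EqOn (diffusionFlux D φ) (fun ξ => C - G ξ + f (φ ξ) - c * φ ξ) (I \ S) := by
    refine Measure.eqOn_open_of_ae_eq (μ := volume) ?_ hopen hflux ?_
    · rw [EventuallyEq, ae_restrict_iff' hopen.measurableSet]
      filter_upwards [hC] with ξ hξ hI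
      have := hξ hI.1
      linarith
    · exact ((((continuousOn_const.sub hGc).add hfφ).sub
        (continuousOn_const.mul hφ.continuousOn))).mono sdiff_subset
  exact ⟨fun ξ => C - G ξ, S, hφ.isOpen, hφ.ordConnected, hφ.mapsTo, hφ.continuousOn,
    fun ξ hξ => (hG ξ hξ).const_sub C, hSf, fun ξ hξ => (hS ξ hξ).1,
    fun ξ hξ hξS => hcl.differentiableAt ξ ⟨hξ, hξS⟩, fun ξ hξ hξS => heq ⟨hξ, hξS⟩⟩

/-! ### Sign of the flux, limits at infinity, monotonicity -/

namespace FluxBalance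

variable {R : ℝ} {D f g : ℝ → ℝ} {c : ℝ} {I : Set ℝ} {φ W : ℝ → ℝ} {S : Set ℝ}

theorem antitoneOn (h : FluxBalance R D f g c I φ W S) (hg : ∀ ρ ∈ Icc 0 R, 0 ≤ g ρ) :
    AntitoneOn W I := by
  refine antitoneOn_of_deriv_nonpos h.ordConnected.convex
    (fun ξ hξ => (h.hasDerivAt ξ hξ).continuousAt.continuousWithinAt)
    (fun ξ hξ => (h.hasDerivAt ξ (interior_subset hξ)).differentiableAt.differentiableWithinAt) ?_
  intro ξ hξ
  rw [(h.hasDerivAt ξ (interior_subset hξ)).deriv, neg_nonpos]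
  exact hg _ (h.mapsTo (interior_subset hξ))

theorem continuousOn_flux (h : FluxBalance R D f g c I φ W S) (hf : ContinuousOn f (Icc 0 R)) :
    ContinuousOn (fun ξ => W ξ + f (φ ξ) - c * φ ξ) I :=
  (ContinuousOn.add (fun ξ hξ => (h.hasDerivAt ξ hξ).continuousAt.continuousWithinAt)
    (hf.comp h.continuousOn h.mapsTo)).sub (continuousOn_const.mul h.continuousOn)

theorem strictMonoOn (h : FluxBalance R D f g c I φ W S) (hD : ∀ ρ ∈ Icc 0 R, 0 ≤ D ρ) {a b : ℝ}
    (hab : Icc a b ⊆ I) (hS : ∀ y ∈ Ioo a b, y ∉ S)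
    (hP : ∀ y ∈ Ioo a b, 0 < W y + f (φ y) - c * φ y) : StrictMonoOn φ (Icc a b) := by
  refine strictMonoOn_of_deriv_pos (convex_Icc a b) (h.continuousOn.mono hab) ?_
  intro y hy
  rw [interior_Icc] at hy
  have hyI := hab (Ioo_subset_Icc_self hy)
  have h1 := hP y hy
  rw [← h.flux_eq y hyI (hS y hy)] at h1
  exact pos_of_mul_pos_right h1 (hD _ (h.mapsTo hyI))

theorem strictAntiOn (h : FluxBalance R D f g c I φ W S) (hD : ∀ ρ ∈ Icc 0 R, 0 ≤ D ρ) {a b : ℝ}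
    (hab : Icc a b ⊆ I) (hS : ∀ y ∈ Ioo a b, y ∉ S)
    (hP : ∀ y ∈ Ioo a b, W y + f (φ y) - c * φ y < 0) : StrictAntiOn φ (Icc a b) := by
  refine strictAntiOn_of_deriv_neg (convex_Icc a b) (h.continuousOn.mono hab) ?_
  intro y hy
  rw [interior_Icc] at hy
  have hyI := hab (Ioo_subset_Icc_self hy)
  have h1 := hP y hy
  rw [← h.flux_eq y hyI (hS y hy)] at h1
  by_contra hn
  exact h1.not_ge (mul_nonneg (hD _ (h.mapsTo hyI)) (not_lt.1 hn))

theorem eventually_notMem (h : FluxBalance R D f g c I φ W S) (x : ℝ) :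
    ∀ᶠ y in 𝓝 x, y ≠ x → y ∉ S := by
  have h1 : IsClosed (S \ {x}) := (h.finite.subset sdiff_subset).isClosed
  filter_upwards [h1.isOpen_compl.mem_nhds (by simp : x ∈ (S \ {x})ᶜ)] with y hy hyx hyS
  exact hy ⟨hyS, hyx⟩

/-- The flux vanishes wherever the profile takes one of its extreme values. -/
theorem flux_eq_zero (h : FluxBalance R D f g c I φ W S) (hf : ContinuousOn f (Icc 0 R))
    (hD : ∀ ρ ∈ Icc 0 R, 0 ≤ D ρ) {x : ℝ} (hx : x ∈ I) (hext : φ x = 0 ∨ φ x = R) :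
    W x + f (φ x) - c * φ x = 0 := by
  have hc := (h.continuousOn_flux hf).continuousAt (h.isOpen.mem_nhds hx)
  -- A nonzero flux keeps its sign near `x`. Then `φ` is strictly monotone, in the same direction,
  -- on both sides of `x`, even if `x` is a sharp point, and so crosses the extreme value `φ x`.
  by_contra hne
  rcases lt_or_gt_of_ne hne with hlt | hgt
  · obtain ⟨δ, hδ, hδ'⟩ := Metric.nhds_basis_closedBall.mem_iff.1 (inter_mem (inter_mem
      (h.isOpen.mem_nhds hx) (h.eventually_notMem x)) (hc.eventually_lt_const hlt))
    rw [Real.closedBall_eq_Icc] at hδ'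
    have s1 : Icc x (x + δ) ⊆ Icc (x - δ) (x + δ) := Icc_subset_Icc_left (by linarith)
    have s2 : Icc (x - δ) x ⊆ Icc (x - δ) (x + δ) := Icc_subset_Icc_right (by linarith)
    have a1 := h.strictAntiOn hD (fun y hy => (hδ' (s1 hy)).1.1)
      (fun y hy => (hδ' (s1 (Ioo_subset_Icc_self hy))).1.2 hy.1.ne')
      (fun y hy => (hδ' (s1 (Ioo_subset_Icc_self hy))).2)
    have a2 := h.strictAntiOn hD (fun y hy => (hδ' (s2 hy)).1.1)
      (fun y hy => (hδ' (s2 (Ioo_subset_Icc_self hy))).1.2 hy.2.ne)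
      (fun y hy => (hδ' (s2 (Ioo_subset_Icc_self hy))).2)
    have b1 := a1 (left_mem_Icc.2 (by linarith)) (right_mem_Icc.2 (by linarith))
      (by linarith : x < x + δ)
    have b2 := a2 (left_mem_Icc.2 (by linarith)) (right_mem_Icc.2 (by linarith))
      (by linarith : x - δ < x)
    have m1 := (h.mapsTo (hδ' (s1 (right_mem_Icc.2 (by linarith)))).1.1).1
    have m2 := (h.mapsTo (hδ' (s2 (left_mem_Icc.2 (by linarith)))).1.1).2
    rcases hext with e | e <;> linarith
  · obtain ⟨δ, hδ, hδ'⟩ := Metric.nhds_basis_closedBall.mem_iff.1 (inter_mem (inter_mem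
      (h.isOpen.mem_nhds hx) (h.eventually_notMem x)) (hc.eventually_const_lt hgt))
    rw [Real.closedBall_eq_Icc] at hδ'
    have s1 : Icc x (x + δ) ⊆ Icc (x - δ) (x + δ) := Icc_subset_Icc_left (by linarith)
    have s2 : Icc (x - δ) x ⊆ Icc (x - δ) (x + δ) := Icc_subset_Icc_right (by linarith)
    have a1 := h.strictMonoOn hD (fun y hy => (hδ' (s1 hy)).1.1)
      (fun y hy => (hδ' (s1 (Ioo_subset_Icc_self hy))).1.2 hy.1.ne')
      (fun y hy => (hδ' (s1 (Ioo_subset_Icc_self hy))).2)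
    have a2 := h.strictMonoOn hD (fun y hy => (hδ' (s2 hy)).1.1)
      (fun y hy => (hδ' (s2 (Ioo_subset_Icc_self hy))).1.2 hy.2.ne)
      (fun y hy => (hδ' (s2 (Ioo_subset_Icc_self hy))).2)
    have b1 := a1 (left_mem_Icc.2 (by linarith)) (right_mem_Icc.2 (by linarith))
      (by linarith : x < x + δ)
    have b2 := a2 (left_mem_Icc.2 (by linarith)) (right_mem_Icc.2 (by linarith))
      (by linarith : x - δ < x)
    have m1 := (h.mapsTo (hδ' (s1 (right_mem_Icc.2 (by linarith)))).1.1).2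
    have m2 := (h.mapsTo (hδ' (s2 (left_mem_Icc.2 (by linarith)))).1.1).1
    rcases hext with e | e <;> linarith

theorem hasDerivAt_profile (h : FluxBalance R D f g c I φ W S) (hD : ∀ ρ ∈ Ioo 0 R, 0 < D ρ)
    (hg : ∀ ρ ∈ Ioo 0 R, 0 < g ρ) {x : ℝ} (hx : x ∈ I) (hφ : φ x ∈ Ioo 0 R) :
    HasDerivAt φ ((W x + f (φ x) - c * φ x) / D (φ x)) x := by
  have hS : x ∉ S := fun hxS => (hg _ hφ).ne' (h.source_eq_zero x hxS)
  rw [← h.flux_eq x hx hS, mul_div_cancel_left₀ _ (hD _ hφ).ne']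
  exact (h.differentiableAt x hx hS).hasDerivAt

/-- To the left of a critical point with a value in `(0, R)` the flux is positive. -/
theorem eventually_flux_pos (h : FluxBalance R D f g c I φ W S)
    (hf : DifferentiableOn ℝ f (Icc 0 R)) (hD : ∀ ρ ∈ Ioo 0 R, 0 < D ρ)
    (hg : ∀ ρ ∈ Ioo 0 R, 0 < g ρ) {x : ℝ} (hx : x ∈ I) (hφ : φ x ∈ Ioo 0 R)
    (h0 : W x + f (φ x) - c * φ x = 0) :
    ∀ᶠ y in 𝓝[<] x, 0 < W y + f (φ y) - c * φ y := by
  have h1 := h.hasDerivAt_profile hD hg hx hφ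
  rw [h0, zero_div] at h1
  have hf1 := ((hf _ (Ioo_subset_Icc_self hφ)).differentiableAt
    (Icc_mem_nhds hφ.1 hφ.2)).hasDerivAt
  -- As `φ' = 0` at `x`, only `W'` contributes: the flux has derivative `-g (φ x) < 0` there.
  have h2 := ((h.hasDerivAt x hx).add (hf1.comp x h1)).sub (h1.const_mul c)
  have h3 := hasDerivWithinAt_iff_tendsto_slope.1 (h2.hasDerivWithinAt (s := Iio x))
  rw [sdiff_singleton_eq_self (by simp)] at h3
  have hneg : -g (φ x) + deriv f (φ x) * 0 - c * 0 < 0 := by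
    have := hg _ hφ
    simpa using this
  filter_upwards [h3.eventually_lt_const hneg, self_mem_nhdsWithin] with y hy hyx
  rw [slope_def_field] at hy
  simp only [Pi.add_apply, Pi.sub_apply, Function.comp_apply] at hy
  rw [h0, sub_zero] at hy
  by_contra hn
  exact hy.not_ge (div_nonneg_of_nonpos (not_lt.1 hn) (sub_nonpos.2 (le_of_lt hyx)))

/-- A profile has no local minimum with a value in `(0, R)`. -/
theorem not_isLocalMin (h : FluxBalance R D f g c I φ W S)
    (hf : DifferentiableOn ℝ f (Icc 0 R)) (hD : ∀ ρ ∈ Ioo 0 R, 0 < D ρ)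
    (hD0 : ∀ ρ ∈ Icc 0 R, 0 ≤ D ρ) (hg : ∀ ρ ∈ Ioo 0 R, 0 < g ρ) {x : ℝ} (hx : x ∈ I)
    (hφ : φ x ∈ Ioo 0 R) : ¬ IsLocalMin φ x := by
  intro hmin
  have h1 := hmin.hasDerivAt_eq_zero (h.hasDerivAt_profile hD hg hx hφ)
  have h2 : W x + f (φ x) - c * φ x = 0 := by
    rcases div_eq_zero_iff.1 h1 with h2 | h2
    · exact h2
    · exact absurd h2 (hD _ hφ).ne'
  have hev := h.eventually_flux_pos hf hD hg hx hφ h2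
  rw [eventually_nhdsWithin_iff] at hev
  obtain ⟨δ, hδ, hδ'⟩ := Metric.nhds_basis_closedBall.mem_iff.1 (inter_mem (inter_mem (inter_mem
    (h.isOpen.mem_nhds hx) (h.eventually_notMem x)) hev) hmin)
  rw [Real.closedBall_eq_Icc] at hδ'
  have s2 : Icc (x - δ) x ⊆ Icc (x - δ) (x + δ) := Icc_subset_Icc_right (by linarith)
  have a2 := h.strictMonoOn hD0 (fun y hy => (hδ' (s2 hy)).1.1.1)
    (fun y hy => (hδ' (s2 (Ioo_subset_Icc_self hy))).1.1.2 hy.2.ne)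
    (fun y hy => (hδ' (s2 (Ioo_subset_Icc_self hy))).1.2 hy.2)
  have b2 := a2 (left_mem_Icc.2 (by linarith)) (right_mem_Icc.2 (by linarith))
    (by linarith : x - δ < x)
  have b3 : φ x ≤ φ (x - δ) := (hδ' (s2 (left_mem_Icc.2 (by linarith)))).2
  linarith

/-- Along unit intervals on which the profile tends to `l` there are points at which `W` tends to
`c l - f(l)`. -/
theorem exists_seq_tendsto (h : FluxBalance R D f g c I φ W S) (hR : 0 ≤ R)
    (hf : ContinuousOn f (Icc 0 R)) (hD : ContinuousOn D (Icc 0 R)) {l : ℝ} (hl : l ∈ Icc 0 R)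
    {F : Filter ℝ} (hφ : Tendsto φ F (𝓝 l)) {a : ℕ → ℝ} (hI : ∀ n, Icc (a n) (a n + 1) ⊆ I)
    (hS : ∀ n, ∀ y ∈ Ioo (a n) (a n + 1), y ∉ S)
    (hF : ∀ x : ℕ → ℝ, (∀ n, x n ∈ Icc (a n) (a n + 1)) → Tendsto x atTop F) :
    ∃ x : ℕ → ℝ, (∀ n, x n ∈ I) ∧ Tendsto x atTop F ∧
      Tendsto (fun n => W (x n)) atTop (𝓝 (c * l - f l)) := by
  -- `E` is a primitive of `D`, so the flux is `(E ∘ φ)'`. By the mean value theorem on a unit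
  -- interval it equals an increment of `E ∘ φ` at some point, and these increments tend to `0`.
  -- Extending `D` makes `E` differentiable at `0` and `R` too.
  set E : ℝ → ℝ := fun ρ => ∫ t in (0 : ℝ)..ρ, IccExtend hR ((Icc 0 R).domRestrict D) t with hE
  have hDc : Continuous (IccExtend hR ((Icc 0 R).domRestrict D)) := hD.domRestrict.Icc_extend'
  have hEd : ∀ ρ ∈ Icc 0 R, HasDerivAt E (D ρ) ρ := by
    intro ρ hρ
    have := intervalIntegral.integral_hasDerivAt_right (hDc.intervalIntegrable 0 ρ)
      (hDc.stronglyMeasurableAtFilter _ _) hDc.continuousAt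
    rwa [IccExtend_of_mem hR _ hρ] at this
  have hmvt : ∀ n, ∃ x ∈ Ioo (a n) (a n + 1),
      W x + f (φ x) - c * φ x = E (φ (a n + 1)) - E (φ (a n)) := by
    intro n
    obtain ⟨x, hx, hx'⟩ := exists_hasDerivAt_eq_slope (fun ξ => E (φ ξ))
      (fun x => W x + f (φ x) - c * φ x) (by linarith : a n < a n + 1)
      (ContinuousOn.comp (t := Icc 0 R)
        (fun ρ hρ => (hEd ρ hρ).continuousAt.continuousWithinAt)
        (h.continuousOn.mono (hI n)) (h.mapsTo.mono_left (hI n)))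
      (fun y hy => by
        have hyI := hI n (Ioo_subset_Icc_self hy)
        rw [← h.flux_eq y hyI (hS n y hy)]
        exact (hEd _ (h.mapsTo hyI)).comp y (h.differentiableAt y hyI (hS n y hy)).hasDerivAt)
    exact ⟨x, hx, by rw [hx', add_sub_cancel_left, div_one]⟩
  choose x hx hxE using hmvt
  have hxI : ∀ n, x n ∈ I := fun n => hI n (Ioo_subset_Icc_self (hx n))
  have hxF := hF x fun n => Ioo_subset_Icc_self (hx n)
  have t1 : Tendsto (fun n => E (φ (a n + 1))) atTop (𝓝 (E l)) :=
    (hEd l hl).continuousAt.tendsto.comp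
      (hφ.comp (hF _ fun n => right_mem_Icc.2 (by linarith)))
  have t2 : Tendsto (fun n => E (φ (a n))) atTop (𝓝 (E l)) :=
    (hEd l hl).continuousAt.tendsto.comp
      (hφ.comp (hF _ fun n => left_mem_Icc.2 (by linarith)))
  have t3 : Tendsto (fun n => φ (x n)) atTop (𝓝 l) := hφ.comp hxF
  have t4 : Tendsto (fun n => f (φ (x n))) atTop (𝓝 (f l)) :=
    (hf l hl).tendsto.comp (tendsto_nhdsWithin_iff.2
      ⟨t3, Eventually.of_forall fun n => h.mapsTo (hxI n)⟩)
  refine ⟨x, hxI, hxF, ?_⟩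
  have t5 := ((t1.sub t2).sub t4).add (t3.const_mul c)
  have e1 : E l - E l - f l + c * l = c * l - f l := by ring
  rw [e1] at t5
  refine t5.congr fun n => ?_
  rw [← hxE n]
  ring

theorem exists_seq_tendsto_atBot (h : FluxBalance R D f g c I φ W S) (hR : 0 ≤ R)
    (hf : ContinuousOn f (Icc 0 R)) (hD : ContinuousOn D (Icc 0 R)) (hI : Iic 0 ⊆ I) {l : ℝ}
    (hl : l ∈ Icc 0 R) (hφ : Tendsto φ atBot (𝓝 l)) :
    ∃ x : ℕ → ℝ, (∀ n, x n ∈ I) ∧ Tendsto x atTop atBot ∧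
      Tendsto (fun n => W (x n)) atTop (𝓝 (c * l - f l)) := by
  obtain ⟨m, hm⟩ := h.finite.bddBelow
  -- The `- 1` puts the right end of each unit interval at or below both `0` and the lower bound `m`
  -- of `S`.
  have hlim : Tendsto (fun n : ℕ => min m 0 - 1 - (n : ℝ)) atTop atBot :=
    tendsto_atBot_add_const_left _ _ (tendsto_neg_atTop_atBot.comp tendsto_natCast_atTop_atTop)
  have hn : ∀ n : ℕ, (0 : ℝ) ≤ n := fun n => n.cast_nonneg
  refine h.exists_seq_tendsto hR hf hD hl hφ (a := fun n => min m 0 - 1 - n) ?_ ?_ ?_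
  · intro n y hy
    refine hI (mem_Iic.2 ?_)
    have := hy.2
    have := hn n
    have := min_le_right m 0
    linarith
  · intro n y hy hyS
    have := hm hyS
    have := hy.2
    have := hn n
    have := min_le_left m 0
    linarith
  · intro x hx
    exact tendsto_atBot_mono (fun n => (hx n).2) (tendsto_atBot_add_const_right _ 1 hlim)

theorem exists_seq_tendsto_atTop (h : FluxBalance R D f g c univ φ W S) (hR : 0 ≤ R)
    (hf : ContinuousOn f (Icc 0 R)) (hD : ContinuousOn D (Icc 0 R)) {l : ℝ}
    (hl : l ∈ Icc 0 R) (hφ : Tendsto φ atTop (𝓝 l)) :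
    ∃ x : ℕ → ℝ, Tendsto x atTop atTop ∧
      Tendsto (fun n => W (x n)) atTop (𝓝 (c * l - f l)) := by
  obtain ⟨m, hm⟩ := h.finite.bddAbove
  have hlim : Tendsto (fun n : ℕ => m + (n : ℝ)) atTop atTop :=
    tendsto_atTop_add_const_left _ _ tendsto_natCast_atTop_atTop
  obtain ⟨x, -, h1, h2⟩ := h.exists_seq_tendsto hR hf hD hl hφ (a := fun n : ℕ => m + n)
    (fun n => subset_univ _)
    (fun n y hy hyS => by
      have := hm hyS
      have := hy.1
      have : (0 : ℝ) ≤ n := n.cast_nonneg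
      linarith)
    (fun x hx => tendsto_atTop_mono (fun n => (hx n).1) hlim)
  exact ⟨x, h1, h2⟩

theorem le_of_tendsto_atBot (h : FluxBalance R D f g c I φ W S) (hR : 0 ≤ R)
    (hf : ContinuousOn f (Icc 0 R)) (hD : ContinuousOn D (Icc 0 R))
    (hg : ∀ ρ ∈ Icc 0 R, 0 ≤ g ρ) (hI : Iic 0 ⊆ I) (hφ : Tendsto φ atBot (𝓝 R)) {ξ : ℝ}
    (hξ : ξ ∈ I) : W ξ ≤ c * R - f R := by
  obtain ⟨x, hxI, hx, hW⟩ := h.exists_seq_tendsto_atBot hR hf hD hI (right_mem_Icc.2 hR) hφ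
  refine ge_of_tendsto hW ?_
  filter_upwards [hx.eventually_le_atBot ξ] with n hn
  exact h.antitoneOn hg (hxI n) hξ hn

theorem nonneg_of_tendsto_atTop (h : FluxBalance R D f g c univ φ W S) (hR : 0 ≤ R)
    (hf : ContinuousOn f (Icc 0 R)) (hf0 : f 0 = 0) (hD : ContinuousOn D (Icc 0 R))
    (hg : ∀ ρ ∈ Icc 0 R, 0 ≤ g ρ) (hφ : Tendsto φ atTop (𝓝 0)) (ξ : ℝ) : 0 ≤ W ξ := by
  obtain ⟨x, hx, hW⟩ := h.exists_seq_tendsto_atTop hR hf hD (left_mem_Icc.2 hR) hφ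
  rw [hf0, mul_zero, sub_zero] at hW
  refine le_of_tendsto hW ?_
  filter_upwards [hx.eventually_ge_atTop ξ] with n hn
  exact h.antitoneOn hg (mem_univ _) (mem_univ _) hn

/-- An antitone `W` with equal end values is constant in between, so `W' = -g(φ)` vanishes there. -/
theorem source_eq_zero_of_eq (h : FluxBalance R D f g c I φ W S) (hg : ∀ ρ ∈ Icc 0 R, 0 ≤ g ρ)
    {a b : ℝ} (ha : a ∈ I) (hb : b ∈ I) (hW : W a = W b) {y : ℝ} (hy : y ∈ Ioo a b) :
    g (φ y) = 0 := by
  have hab : Icc a b ⊆ I := h.ordConnected.out ha hb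
  have hyI := hab (Ioo_subset_Icc_self hy)
  have hanti := h.antitoneOn hg
  have h1 : W =ᶠ[𝓝 y] fun _ => W a := by
    filter_upwards [Ioo_mem_nhds hy.1 hy.2] with t ht
    have htI := hab (Ioo_subset_Icc_self ht)
    exact le_antisymm (hanti ha htI ht.1.le) (hW ▸ hanti htI hb ht.2.le)
  have h2 := (h.hasDerivAt y hyI).unique ((hasDerivAt_const y (W a)).congr_of_eventuallyEq h1)
  linarith

/-- A profile on `ℝ` from `R` to `0` is antitone. -/
theorem antitone_of_tendsto (h : FluxBalance R D f g c univ φ W S) (hR : 0 < R)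
    (hf : DifferentiableOn ℝ f (Icc 0 R)) (hf0 : f 0 = 0) (hD : ContinuousOn D (Icc 0 R))
    (hDpos : ∀ ρ ∈ Ioo 0 R, 0 < D ρ) (hD0 : ∀ ρ ∈ Icc 0 R, 0 ≤ D ρ)
    (hg : ∀ ρ ∈ Ioo 0 R, 0 < g ρ) (hg0 : ∀ ρ ∈ Icc 0 R, 0 ≤ g ρ)
    (hbot : Tendsto φ atBot (𝓝 R)) (htop : Tendsto φ atTop (𝓝 0)) : Antitone φ := by
  have hcont : Continuous φ := continuousOn_univ.1 h.continuousOn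
  have hW : Antitone W := fun a b hab => h.antitoneOn hg0 (mem_univ _) (mem_univ _) hab
  have hmem : ∀ ξ, φ ξ ∈ Icc 0 R := fun ξ => h.mapsTo (mem_univ ξ)
  -- Zero flux at `a` gives `W a = 0`. Since `W` is antitone and nonnegative it vanishes at `b` too,
  -- so `g(φ) = 0` in between, although `φ` would take the value `φ b / 2`, where `g > 0`.
  have hzero : ∀ a b, a ≤ b → φ a = 0 → φ b = 0 := by
    intro a b hab ha
    by_contra hb
    have hbpos : 0 < φ b := lt_of_le_of_ne (hmem b).1 (Ne.symm hb)
    have h1 := h.flux_eq_zero hf.continuousOn hD0 (mem_univ a) (Or.inl ha)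
    rw [ha, hf0] at h1
    have h2 := h.nonneg_of_tendsto_atTop hR.le hf.continuousOn hf0 hD hg0 htop b
    have h3 := hW hab
    obtain ⟨y, hy, hy'⟩ := intermediate_value_Ioo hab hcont.continuousOn
      (show φ b / 2 ∈ Ioo (φ a) (φ b) from ⟨by linarith, by linarith⟩)
    have h4 := h.source_eq_zero_of_eq hg0 (mem_univ a) (mem_univ b) (by linarith) hy
    refine (hg (φ y) ?_).ne' h4
    rw [hy']
    exact ⟨by linarith, by linarith [(hmem b).2]⟩
  -- The mirror argument, with `c R - f R` as upper bound of `W` in place of the lower bound `0`.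
  have hright : ∀ a b, a ≤ b → φ b = R → φ a = R := by
    intro a b hab hb
    by_contra ha
    have hapos : φ a < R := lt_of_le_of_ne (hmem a).2 ha
    have h1 := h.flux_eq_zero hf.continuousOn hD0 (mem_univ b) (Or.inr hb)
    rw [hb] at h1
    have h2 := h.le_of_tendsto_atBot hR.le hf.continuousOn hD hg0 (subset_univ _) hbot (mem_univ a)
    have h3 := hW hab
    obtain ⟨y, hy, hy'⟩ := intermediate_value_Ioo hab hcont.continuousOn
      (show (φ a + R) / 2 ∈ Ioo (φ a) (φ b) from ⟨by linarith, by linarith⟩)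
    have h4 := h.source_eq_zero_of_eq hg0 (mem_univ a) (mem_univ b) (by linarith) hy
    refine (hg (φ y) ?_).ne' h4
    rw [hy']
    exact ⟨by linarith [(hmem a).1], by linarith⟩
  intro a b hab
  by_contra! hlt
  have hbR : φ b < R := by
    refine lt_of_le_of_ne (hmem b).2 fun hb => ?_
    have := hright a b hab hb
    linarith
  -- Far to the left `φ` exceeds `φ a`, and so does `φ b`. The minimum over `[p, b]` is therefore
  -- attained inside, at a value in `(0, R)`.
  obtain ⟨p, hp1, hp2⟩ := ((hbot.eventually_const_lt (hlt.trans hbR)).and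
    (eventually_lt_atBot a)).exists
  have hab' : a < b := lt_of_le_of_ne hab fun e => hlt.ne (by rw [e])
  obtain ⟨x, hx, hxmin⟩ := isCompact_Icc.exists_isMinOn (nonempty_Icc.2 (hp2.le.trans hab))
    hcont.continuousOn
  have hxa : φ x ≤ φ a := hxmin ⟨hp2.le, hab⟩
  have hxp : p < x := lt_of_le_of_ne hx.1 fun e => by rw [← e] at hxa; linarith
  have hxb : x < b := lt_of_le_of_ne hx.2 fun e => by rw [e] at hxa; linarith
  have hx0 : 0 < φ x := by
    refine lt_of_le_of_ne (hmem x).1 fun e => ?_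
    have := hzero x b hxb.le e.symm
    linarith [(hmem a).1]
  exact h.not_isLocalMin hf hDpos hD0 hg (mem_univ x) ⟨hx0, by linarith⟩
    (hxmin.isLocalMin (Icc_mem_nhds hxp hxb))

end FluxBalance

/-! ### Decreasing profiles and their inverses -/

/-- A profile on `I` that decreases from `R` at `-∞` and takes the value `R / 2` at `0`, together
with the integrated flux `W`. -/
structure DecreasingProfile (R : ℝ) (D f g : ℝ → ℝ) (c : ℝ) (I : Set ℝ) (φ W : ℝ → ℝ) :
    Prop where
  isOpen : IsOpen I
  ordConnected : I.OrdConnected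
  Iic_subset : Iic 0 ⊆ I
  mapsTo : MapsTo φ I (Icc 0 R)
  continuousOn : ContinuousOn φ I
  antitoneOn : AntitoneOn φ I
  tendsto : Tendsto φ atBot (𝓝 R)
  apply_zero : φ 0 = R / 2
  antitoneOn_flux : AntitoneOn W I
  hasDerivAt_flux : ∀ ξ ∈ I, HasDerivAt W (-g (φ ξ)) ξ
  le : ∀ ξ ∈ I, W ξ ≤ c * R - f R
  exists_gt : ∀ ε > 0, ∃ ξ ∈ I, φ ξ ∈ Ioo 0 R ∧ c * R - f R - ε < W ξ
  diffusion_pos : ∀ ρ ∈ Ioo 0 R, 0 < D ρ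
  source_pos : ∀ ρ ∈ Ioo 0 R, 0 < g ρ
  flux_neg : ∀ ξ ∈ I, φ ξ ∈ Ioo 0 R → W ξ + f (φ ξ) - c * φ ξ < 0
  hasDerivAt : ∀ ξ ∈ I, φ ξ ∈ Ioo 0 R →
    HasDerivAt φ ((W ξ + f (φ ξ) - c * φ ξ) / D (φ ξ)) ξ

theorem FluxBalance.decreasingProfile {R : ℝ} {D f g : ℝ → ℝ} {c : ℝ} {I : Set ℝ}
    {φ W : ℝ → ℝ} {S : Set ℝ} (h : FluxBalance R D f g c I φ W S) (hR : 0 < R)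
    (hf : DifferentiableOn ℝ f (Icc 0 R)) (hD : ContinuousOn D (Icc 0 R))
    (hDpos : ∀ ρ ∈ Ioo 0 R, 0 < D ρ) (hD0 : ∀ ρ ∈ Icc 0 R, 0 ≤ D ρ)
    (hg : ∀ ρ ∈ Ioo 0 R, 0 < g ρ) (hg0 : ∀ ρ ∈ Icc 0 R, 0 ≤ g ρ) (hI : Iic 0 ⊆ I)
    (hanti : AntitoneOn φ I) (hbot : Tendsto φ atBot (𝓝 R)) (h0 : φ 0 = R / 2) :
    DecreasingProfile R D f g c I φ W := by
  have h0I : (0 : ℝ) ∈ I := hI self_mem_Iic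
  have hle : ∀ ξ ∈ I, W ξ ≤ c * R - f R := fun ξ hξ =>
    h.le_of_tendsto_atBot hR.le hf.continuousOn hD hg0 hI hbot hξ
  refine ⟨h.isOpen, h.ordConnected, hI, h.mapsTo, h.continuousOn, hanti, hbot, h0,
    h.antitoneOn hg0, h.hasDerivAt, hle, ?_, hDpos, hg, ?_,
    fun ξ hξ hφ => h.hasDerivAt_profile hDpos hg hξ hφ⟩
  · intro ε hε
    rcases lt_or_ge (c * R - f R - ε) (W 0) with hW0 | hW0
    · exact ⟨0, h0I, by rw [h0]; exact ⟨by linarith, by linarith⟩, hW0⟩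
    obtain ⟨x, hxI, hx, hW⟩ := h.exists_seq_tendsto_atBot hR.le hf.continuousOn hD hI
      (right_mem_Icc.2 hR.le) hbot
    obtain ⟨n, hn1, hn2⟩ := ((hW.eventually_const_lt
      (by linarith : c * R - f R - ε < c * R - f R)).and (hx.eventually_le_atBot 0)).exists
    have hpos : ∀ ξ ≤ (0 : ℝ), 0 < φ ξ := fun ξ hξ => by
      have := hanti (hI hξ) h0I hξ
      linarith
    have hsub : Icc (x n) 0 ⊆ I := fun y hy => hI hy.2
    -- The profile may equal `R` on a half-line, so `x n` itself need not serve. A value of `W`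
    -- strictly below `c R - f R` excludes `φ y = R`, where the flux would vanish.
    obtain ⟨y, hy, hyW⟩ := intermediate_value_Ioc' hn2 (f := W)
      (fun ξ hξ => (h.hasDerivAt ξ (hsub hξ)).continuousAt.continuousWithinAt)
      (show (W (x n) + (c * R - f R - ε)) / 2 ∈ Ico (W 0) (W (x n)) from
        ⟨by linarith, by linarith⟩)
    have hxn := hle _ (hxI n)
    have hy1 : c * R - f R - ε < W y := by linarith
    have hy2 : W y < c * R - f R := by linarith
    have hyI : y ∈ I := hI hy.2
    refine ⟨y, hyI, ⟨hpos y hy.2, lt_of_le_of_ne (h.mapsTo hyI).2 fun e => ?_⟩, hy1⟩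
    have h1 := h.flux_eq_zero hf.continuousOn hD0 hyI (Or.inr e)
    rw [e] at h1
    linarith
  · have hle0 : ∀ ξ ∈ I, φ ξ ∈ Ioo 0 R → W ξ + f (φ ξ) - c * φ ξ ≤ 0 := by
      intro ξ hξ hφ
      have h1 := h.hasDerivAt_profile hDpos hg hξ hφ
      have h2 : (W ξ + f (φ ξ) - c * φ ξ) / D (φ ξ) ≤ 0 := by
        refine le_of_not_gt fun hlt => ?_
        have h3 := hasDerivWithinAt_iff_tendsto_slope.1 (h1.hasDerivWithinAt (s := Iio ξ))
        rw [sdiff_singleton_eq_self (by simp)] at h3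
        obtain ⟨y, ⟨hy1, hy2⟩, hy3⟩ := ((h3.eventually_const_lt hlt).and
          (self_mem_nhdsWithin (a := ξ) (s := Iio ξ))|>.and
          (mem_nhdsWithin_of_mem_nhds (h.isOpen.mem_nhds hξ))).exists
        rw [slope_def_field] at hy1
        have := hanti hy3 hξ (le_of_lt hy2)
        have hy2' : y < ξ := hy2
        exact hy1.not_ge (div_nonpos_of_nonneg_of_nonpos (by linarith) (by linarith))
      by_contra! hn
      exact h2.not_gt (div_pos hn (hDpos _ hφ))
    intro ξ hξ hφ
    -- Zero flux at `ξ` would make it positive just to the left, against `hle0`.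
    refine lt_of_le_of_ne (hle0 ξ hξ hφ) fun e => ?_
    have hnhds : ∀ᶠ y in 𝓝 ξ, y ∈ I ∧ φ y ∈ Ioo 0 R :=
      Eventually.and (h.isOpen.mem_nhds hξ) ((h.continuousOn.continuousAt (h.isOpen.mem_nhds hξ)).eventually
        (Ioo_mem_nhds hφ.1 hφ.2))
    obtain ⟨y, hy1, hy2⟩ := ((h.eventually_flux_pos hf hDpos hg hξ hφ e).and
      (mem_nhdsWithin_of_mem_nhds hnhds)).exists
    exact hy1.not_ge (hle0 y hy2.1 hy2.2)

namespace DecreasingProfile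

variable {R : ℝ} {D f g : ℝ → ℝ} {c : ℝ} {I : Set ℝ} {φ W : ℝ → ℝ}

/-- Equality would force `φ` to be constant between `a` and `b`, but `φ' < 0` at values in `(0, R)`.
-/
theorem apply_lt_apply (h : DecreasingProfile R D f g c I φ W) {a b : ℝ} (ha : a ∈ I) (hb : b ∈ I)
    (hab : a < b) (hφ : φ b ∈ Ioo 0 R) : φ b < φ a := by
  refine lt_of_le_of_ne (h.antitoneOn ha hb hab.le) fun e => ?_
  obtain ⟨y, hy⟩ := exists_between hab
  have hsub : Icc a b ⊆ I := h.ordConnected.out ha hb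
  have hconst : ∀ t ∈ Ioo a b, φ t = φ b := fun t ht => by
    have htI := hsub (Ioo_subset_Icc_self ht)
    exact le_antisymm (e ▸ h.antitoneOn ha htI ht.1.le) (h.antitoneOn htI hb ht.2.le)
  have hyI := hsub (Ioo_subset_Icc_self hy)
  have hyφ : φ y ∈ Ioo 0 R := by rw [hconst y hy]; exact hφ
  have h1 : φ =ᶠ[𝓝 y] fun _ => φ b := by
    filter_upwards [Ioo_mem_nhds hy.1 hy.2] with t ht using hconst t ht
  have h2 := (h.hasDerivAt y hyI hyφ).unique
    ((hasDerivAt_const y (φ b)).congr_of_eventuallyEq h1)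
  exact (div_neg_of_neg_of_pos (h.flux_neg y hyI hyφ) (h.diffusion_pos _ hyφ)).ne h2

theorem zero_mem (h : DecreasingProfile R D f g c I φ W) : (0 : ℝ) ∈ I := h.Iic_subset self_mem_Iic

theorem mem_image_of_le (h : DecreasingProfile R D f g c I φ W) {ρ σ : ℝ} (hρ : ρ ∈ φ '' I)
    (hρσ : ρ ≤ σ) (hσ : σ < R) : σ ∈ φ '' I := by
  obtain ⟨ξ, hξ, rfl⟩ := hρ
  obtain ⟨a, ha1, ha2⟩ := ((h.tendsto.eventually_const_lt hσ).and
    (eventually_le_atBot (min 0 ξ))).exists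
  have haI : a ∈ I := h.Iic_subset (ha2.trans (min_le_left _ _))
  obtain ⟨y, hy, rfl⟩ := intermediate_value_Icc' (ha2.trans (min_le_right _ _))
    (h.continuousOn.mono (h.ordConnected.out haI hξ)) ⟨hρσ, ha1.le⟩
  exact ⟨y, h.ordConnected.out haI hξ hy, rfl⟩

/-- The inverse of the profile. -/
noncomputable def inv (_ : DecreasingProfile R D f g c I φ W) : ℝ → ℝ := Function.invFunOn φ I

theorem inv_mem (h : DecreasingProfile R D f g c I φ W) {ρ : ℝ} (hρ : ρ ∈ φ '' I) :
    h.inv ρ ∈ I := Function.invFunOn_mem hρ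

theorem apply_inv (h : DecreasingProfile R D f g c I φ W) {ρ : ℝ} (hρ : ρ ∈ φ '' I) :
    φ (h.inv ρ) = ρ := Function.invFunOn_eq hρ

theorem inv_apply (h : DecreasingProfile R D f g c I φ W) {ξ : ℝ} (hξ : ξ ∈ I)
    (hφ : φ ξ ∈ Ioo 0 R) : h.inv (φ ξ) = ξ := by
  have hm := h.inv_mem (mem_image_of_mem φ hξ)
  have he := h.apply_inv (mem_image_of_mem φ hξ)
  rcases lt_trichotomy (h.inv (φ ξ)) ξ with hlt | heq | hgt
  · exact absurd he (h.apply_lt_apply hm hξ hlt hφ).ne'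
  · exact heq
  · exact absurd he (h.apply_lt_apply hξ hm hgt (by rw [he]; exact hφ)).ne

theorem inv_half (h : DecreasingProfile R D f g c I φ W) (hR : 0 < R) : h.inv (R / 2) = 0 := by
  have h1 := h.inv_apply h.zero_mem (by rw [h.apply_zero]; exact ⟨by linarith, by linarith⟩)
  rwa [h.apply_zero] at h1

theorem half_mem (h : DecreasingProfile R D f g c I φ W) : R / 2 ∈ φ '' I :=
  ⟨0, h.zero_mem, h.apply_zero⟩

theorem eventually_mem_image (h : DecreasingProfile R D f g c I φ W) {ρ : ℝ} (hρ : ρ ∈ φ '' I)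
    (hρ' : ρ ∈ Ioo 0 R) :
    (∀ᶠ σ in 𝓝 ρ, σ ∈ φ '' I) ∧ ContinuousAt h.inv ρ := by
  have hξ := h.inv_mem hρ
  have hφξ := h.apply_inv hρ
  set ξ := h.inv ρ with hξdef
  have hφ : φ ξ ∈ Ioo 0 R := by rw [hφξ]; exact hρ'
  have key : ∀ ε > 0, ∀ᶠ σ in 𝓝 ρ, σ ∈ φ '' I ∧ h.inv σ ∈ Ioo (ξ - ε) (ξ + ε) := by
    intro ε' hε'
    obtain ⟨δ, hδ, hδI⟩ := Metric.nhds_basis_closedBall.mem_iff.1 (inter_mem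
      (h.isOpen.mem_nhds hξ) ((h.continuousOn.continuousAt (h.isOpen.mem_nhds hξ)).eventually
        (Ioo_mem_nhds hφ.1 hφ.2)))
    rw [Real.closedBall_eq_Icc] at hδI
    set ε := min δ ε' with hε
    have hεpos : 0 < ε := lt_min hδ hε'
    have hεδ : ε ≤ δ := min_le_left _ _
    have hεε : ε ≤ ε' := min_le_right _ _
    have m1 := hδI (show ξ - ε ∈ Icc (ξ - δ) (ξ + δ) from ⟨by linarith, by linarith⟩)
    have m2 := hδI (show ξ + ε ∈ Icc (ξ - δ) (ξ + δ) from ⟨by linarith, by linarith⟩)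
    have b1 := h.apply_lt_apply m1.1 hξ (by linarith : ξ - ε < ξ) hφ
    have b2 := h.apply_lt_apply hξ m2.1 (by linarith : ξ < ξ + ε) m2.2
    rw [hφξ] at b1 b2
    filter_upwards [Ioo_mem_nhds b2 b1] with σ hσ
    have hσ' := h.mem_image_of_le (mem_image_of_mem φ m2.1) hσ.1.le (hσ.2.trans m1.2.2)
    have hi := h.inv_mem hσ'
    have he := h.apply_inv hσ'
    refine ⟨hσ', ?_, ?_⟩
    · by_contra! hn
      have := h.antitoneOn hi m1.1 (by linarith)
      linarith [hσ.2]
    · by_contra! hn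
      have := h.antitoneOn m2.1 hi (by linarith)
      linarith [hσ.1]
  refine ⟨(key 1 one_pos).mono fun σ hσ => hσ.1, Metric.continuousAt_iff'.2 fun ε hε => ?_⟩
  filter_upwards [key ε hε] with σ hσ
  rw [← hξdef, Real.dist_eq, abs_lt]
  exact ⟨by linarith [hσ.2.1], by linarith [hσ.2.2]⟩

theorem hasDerivAt_inv (h : DecreasingProfile R D f g c I φ W) {ρ : ℝ} (hρ : ρ ∈ φ '' I)
    (hρ' : ρ ∈ Ioo 0 R) :
    HasDerivAt h.inv (D ρ / (W (h.inv ρ) + f ρ - c * ρ)) ρ := by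
  obtain ⟨h1, h2⟩ := h.eventually_mem_image hρ hρ'
  have e := h.apply_inv hρ
  have h3 := h.hasDerivAt (h.inv ρ) (h.inv_mem hρ) (by rw [e]; exact hρ')
  have h4 := h.flux_neg (h.inv ρ) (h.inv_mem hρ) (by rw [e]; exact hρ')
  rw [e] at h3 h4
  have h5 := h3.of_local_left_inverse h2 (div_neg_of_neg_of_pos h4 (h.diffusion_pos _ hρ')).ne
    (h1.mono fun σ hσ => h.apply_inv hσ)
  rwa [inv_div] at h5

/-- The first-order equation for the flux in the variable `ρ`; position no longer appears except
through `W ∘ h.inv`, so profiles with different sources become comparable. -/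
theorem hasDerivAt_flux_inv (h : DecreasingProfile R D f g c I φ W) {ρ : ℝ} (hρ : ρ ∈ φ '' I)
    (hρ' : ρ ∈ Ioo 0 R) :
    HasDerivAt (fun ρ => W (h.inv ρ)) (-g ρ * (D ρ / (W (h.inv ρ) + f ρ - c * ρ))) ρ := by
  have h1 := h.hasDerivAt_flux (h.inv ρ) (h.inv_mem hρ)
  rw [h.apply_inv hρ] at h1
  exact h1.comp ρ (h.hasDerivAt_inv hρ hρ')

theorem flux_inv_neg (h : DecreasingProfile R D f g c I φ W) {ρ : ℝ} (hρ : ρ ∈ φ '' I)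
    (hρ' : ρ ∈ Ioo 0 R) : W (h.inv ρ) + f ρ - c * ρ < 0 := by
  have h1 := h.flux_neg (h.inv ρ) (h.inv_mem hρ) (by rw [h.apply_inv hρ]; exact hρ')
  rwa [h.apply_inv hρ] at h1

/-! ### Comparison of two profiles -/

variable {g₁ g₂ : ℝ → ℝ} {I₁ I₂ : Set ℝ} {φ₁ φ₂ W₁ W₂ : ℝ → ℝ}

/-- The flux, as a function of the value of the profile, is strictly decreasing in the source. -/
theorem flux_inv_lt (h₁ : DecreasingProfile R D f g₁ c I₁ φ₁ W₁)
    (h₂ : DecreasingProfile R D f g₂ c I₂ φ₂ W₂) (hg : ∀ ρ ∈ Ioo 0 R, g₂ ρ < g₁ ρ) {ρ₀ : ℝ}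
    (hρ₁ : ρ₀ ∈ φ₁ '' I₁) (hρ₂ : ρ₀ ∈ φ₂ '' I₂) (hρ : ρ₀ ∈ Ioo 0 R) :
    W₁ (h₁.inv ρ₀) < W₂ (h₂.inv ρ₀) := by
  by_contra! hle
  have m₁ : ∀ ρ, ρ₀ ≤ ρ → ρ < R → ρ ∈ φ₁ '' I₁ := fun ρ a b => h₁.mem_image_of_le hρ₁ a b
  have m₂ : ∀ ρ, ρ₀ ≤ ρ → ρ < R → ρ ∈ φ₂ '' I₂ := fun ρ a b => h₂.mem_image_of_le hρ₂ a b
  set k : ℝ → ℝ := fun ρ => W₁ (h₁.inv ρ) - W₂ (h₂.inv ρ) with hk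
  set k' : ℝ → ℝ := fun ρ => -g₁ ρ * (D ρ / (W₁ (h₁.inv ρ) + f ρ - c * ρ)) -
    -g₂ ρ * (D ρ / (W₂ (h₂.inv ρ) + f ρ - c * ρ)) with hk'
  have hkd : ∀ ρ, ρ₀ ≤ ρ → ρ < R → HasDerivAt k (k' ρ) ρ := fun ρ a b =>
    (h₁.hasDerivAt_flux_inv (m₁ ρ a b) ⟨hρ.1.trans_le a, b⟩).sub
      (h₂.hasDerivAt_flux_inv (m₂ ρ a b) ⟨hρ.1.trans_le a, b⟩)
  have hkpos : ∀ ρ, ρ₀ ≤ ρ → ρ < R → 0 ≤ k ρ → 0 < k' ρ := by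
    intro ρ a b h0
    have hm : ρ ∈ Ioo 0 R := ⟨hρ.1.trans_le a, b⟩
    have z₁ := h₁.flux_inv_neg (m₁ ρ a b) hm
    have z₂ := h₂.flux_inv_neg (m₂ ρ a b) hm
    have hDρ := h₁.diffusion_pos ρ hm
    have hg₂ := h₂.source_pos ρ hm
    have hgg := hg ρ hm
    have hz : W₂ (h₂.inv ρ) + f ρ - c * ρ ≤ W₁ (h₁.inv ρ) + f ρ - c * ρ := by
      simp only [hk] at h0
      linarith
    simp only [hk']
    generalize W₁ (h₁.inv ρ) + f ρ - c * ρ = a₁ at *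
    generalize W₂ (h₂.inv ρ) + f ρ - c * ρ = a₂ at *
    have e1 : D ρ / -a₂ ≤ D ρ / -a₁ :=
      div_le_div_of_nonneg_left hDρ.le (by linarith) (by linarith)
    have e2 : 0 < D ρ / -a₂ := div_pos hDρ (by linarith)
    rw [div_neg] at e1 e2
    rw [div_neg] at e1
    nlinarith
  -- A barrier argument: `k` cannot cross `0` downwards, because `k' > 0` wherever `k = 0`.
  have hk0 : ∀ ρ, ρ₀ ≤ ρ → ρ < R → 0 ≤ k ρ := by
    intro ρ a b
    have := image_le_of_deriv_right_lt_deriv_boundary' (f := fun ρ => -k ρ)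
      (f' := fun ρ => -k' ρ) (B := fun _ => 0) (B' := fun _ => 0) (a := ρ₀) (b := ρ)
      (fun x hx => (hkd x hx.1 (hx.2.trans_lt b)).neg.continuousAt.continuousWithinAt)
      (fun x hx => (hkd x hx.1 (hx.2.trans b)).neg.hasDerivWithinAt)
      (by simpa [hk] using hle) continuousOn_const
      (fun x _ => hasDerivWithinAt_const x _ _)
      (fun x hx hx0 => by
        have := hkpos x hx.1 (hx.2.trans b) (by linarith)
        linarith)
      (right_mem_Icc.2 a)
    linarith
  have hmono : ∀ s t, ρ₀ ≤ s → s < t → t < R → k s < k t := by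
    intro s t hs hst ht
    refine strictMonoOn_of_deriv_pos (convex_Icc s t)
      (fun x hx => (hkd x (hs.trans hx.1) (hx.2.trans_lt ht)).continuousAt.continuousWithinAt) ?_
      (left_mem_Icc.2 hst.le) (right_mem_Icc.2 hst.le) hst
    intro x hx
    rw [interior_Icc] at hx
    have h1 := hs.trans hx.1.le
    have h2 := hx.2.trans ht
    rw [(hkd x h1 h2).deriv]
    exact hkpos x h1 h2 (hk0 x h1 h2)
  obtain ⟨σ, hσ1, hσ2⟩ := exists_between hρ.2
  have hδ : 0 < k σ := (hk0 ρ₀ le_rfl hρ.2).trans_lt (hmono ρ₀ σ le_rfl hσ1 hσ2)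
  -- The gap is at least `k σ` beyond `σ`, while `W₂` comes within `k σ` of `c R - f R`. At `τ`,
  -- beyond both `σ` and `φ₂ ξ`, this pushes `W₁` above its bound.
  obtain ⟨ξ, hξ, hξφ, hξW⟩ := h₂.exists_gt (k σ) hδ
  set τ := max σ (φ₂ ξ) with hτ
  have hτR : τ < R := max_lt hσ2 hξφ.2
  have hτσ : σ ≤ τ := le_max_left _ _
  have hkτ : k σ ≤ k τ := by
    rcases hτσ.eq_or_lt with e | hlt
    · rw [← e]
    · exact (hmono σ τ hσ1.le hlt hτR).le
  have n₁ := m₁ τ (hσ1.le.trans hτσ) hτR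
  have n₂ := m₂ τ (hσ1.le.trans hτσ) hτR
  have c1 := h₁.le _ (h₁.inv_mem n₁)
  have c2 : W₂ ξ ≤ W₂ (h₂.inv τ) := by
    refine h₂.antitoneOn_flux (h₂.inv_mem n₂) hξ ?_
    by_contra! hlt
    have := h₂.apply_lt_apply hξ (h₂.inv_mem n₂) hlt
      (by rw [h₂.apply_inv n₂]; exact ⟨hρ.1.trans_le (hσ1.le.trans hτσ), hτR⟩)
    rw [h₂.apply_inv n₂] at this
    exact this.not_ge (le_max_right _ _)
  simp only [hk] at hkτ hξW
  linarith

/-- The larger source has the more negative flux, hence the steeper profile at equal values: `D / z₁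
> D / z₂`. -/
theorem inv_sub_inv_strictMonoOn (h₁ : DecreasingProfile R D f g₁ c I₁ φ₁ W₁)
    (h₂ : DecreasingProfile R D f g₂ c I₂ φ₂ W₂) (hg : ∀ ρ ∈ Ioo 0 R, g₂ ρ < g₁ ρ) {s t : ℝ}
    (hs₁ : s ∈ φ₁ '' I₁) (hs₂ : s ∈ φ₂ '' I₂) (hs : 0 < s) (ht : t < R) :
    StrictMonoOn (fun ρ => h₁.inv ρ - h₂.inv ρ) (Icc s t) := by
  have hd : ∀ x ∈ Icc s t, HasDerivAt (fun ρ => h₁.inv ρ - h₂.inv ρ)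
      (D x / (W₁ (h₁.inv x) + f x - c * x) - D x / (W₂ (h₂.inv x) + f x - c * x)) x := fun x hx =>
    (h₁.hasDerivAt_inv (h₁.mem_image_of_le hs₁ hx.1 (hx.2.trans_lt ht))
      ⟨hs.trans_le hx.1, hx.2.trans_lt ht⟩).sub
    (h₂.hasDerivAt_inv (h₂.mem_image_of_le hs₂ hx.1 (hx.2.trans_lt ht))
      ⟨hs.trans_le hx.1, hx.2.trans_lt ht⟩)
  refine strictMonoOn_of_deriv_pos (convex_Icc s t)
    (fun x hx => (hd x hx).continuousAt.continuousWithinAt) ?_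
  intro x hx
  replace hx := interior_subset hx
  rw [(hd x hx).deriv]
  have hm : x ∈ Ioo 0 R := ⟨hs.trans_le hx.1, hx.2.trans_lt ht⟩
  have n₁ := h₁.mem_image_of_le hs₁ hx.1 hm.2
  have n₂ := h₂.mem_image_of_le hs₂ hx.1 hm.2
  have z₂ := h₂.flux_inv_neg n₂ hm
  have hlt := h₁.flux_inv_lt h₂ hg n₁ n₂ hm
  have := div_lt_div_of_pos_left (h₁.diffusion_pos x hm) (neg_pos.2 z₂)
    (by linarith : -(W₂ (h₂.inv x) + f x - c * x) < -(W₁ (h₁.inv x) + f x - c * x))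
  rw [div_neg, div_neg] at this
  linarith

theorem inv_lt_inv_of_half_lt (h₁ : DecreasingProfile R D f g₁ c I₁ φ₁ W₁)
    (h₂ : DecreasingProfile R D f g₂ c I₂ φ₂ W₂) (hg : ∀ ρ ∈ Ioo 0 R, g₂ ρ < g₁ ρ) (hR : 0 < R)
    {ρ : ℝ} (hρ : R / 2 < ρ) (hρR : ρ < R) : h₂.inv ρ < h₁.inv ρ := by
  have := h₁.inv_sub_inv_strictMonoOn h₂ hg h₁.half_mem h₂.half_mem (by linarith) hρR
    (left_mem_Icc.2 hρ.le) (right_mem_Icc.2 hρ.le) hρ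
  simp only [h₁.inv_half hR, h₂.inv_half hR] at this
  linarith

theorem inv_lt_inv_of_lt_half (h₁ : DecreasingProfile R D f g₁ c I₁ φ₁ W₁)
    (h₂ : DecreasingProfile R D f g₂ c I₂ φ₂ W₂) (hg : ∀ ρ ∈ Ioo 0 R, g₂ ρ < g₁ ρ) (hR : 0 < R)
    {ρ : ℝ} (hρ₁ : ρ ∈ φ₁ '' I₁) (hρ₂ : ρ ∈ φ₂ '' I₂) (hρ0 : 0 < ρ) (hρ : ρ < R / 2) :
    h₁.inv ρ < h₂.inv ρ := by
  have := h₁.inv_sub_inv_strictMonoOn h₂ hg hρ₁ hρ₂ hρ0 (by linarith : R / 2 < R)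
    (left_mem_Icc.2 hρ.le) (right_mem_Icc.2 hρ.le) hρ
  simp only [h₁.inv_half hR, h₂.inv_half hR] at this
  linarith

theorem lt_of_neg (h₁ : DecreasingProfile R D f g₁ c I₁ φ₁ W₁)
    (h₂ : DecreasingProfile R D f g₂ c I₂ φ₂ W₂) (hg : ∀ ρ ∈ Ioo 0 R, g₂ ρ < g₁ ρ) (hR : 0 < R)
    {ξ : ℝ} (hξ : ξ < 0) (hφ : φ₂ ξ < R) : φ₂ ξ < φ₁ ξ := by
  have i₁ := h₁.Iic_subset hξ.le
  have i₂ := h₂.Iic_subset hξ.le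
  have a1 := h₂.apply_lt_apply i₂ h₂.zero_mem hξ
    (by rw [h₂.apply_zero]; exact ⟨by linarith, by linarith⟩)
  rw [h₂.apply_zero] at a1
  have hm : φ₂ ξ ∈ Ioo 0 R := ⟨by linarith, hφ⟩
  have a2 := h₁.inv_lt_inv_of_half_lt h₂ hg hR a1 hφ
  rw [h₂.inv_apply i₂ hm] at a2
  have n₁ := h₁.mem_image_of_le h₁.half_mem a1.le hφ
  have a3 := h₁.apply_lt_apply i₁ (h₁.inv_mem n₁) a2 (by rw [h₁.apply_inv n₁]; exact hm)
  rwa [h₁.apply_inv n₁] at a3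

/-- If `φ₁ ξ < R`, then `φ₂` takes the value `φ₁ ξ` to the left of `ξ`, and so has already left `R`
at `ξ`. -/
theorem eq_of_neg (h₁ : DecreasingProfile R D f g₁ c I₁ φ₁ W₁)
    (h₂ : DecreasingProfile R D f g₂ c I₂ φ₂ W₂) (hg : ∀ ρ ∈ Ioo 0 R, g₂ ρ < g₁ ρ) (hR : 0 < R)
    {ξ : ℝ} (hξ : ξ < 0) (hφ : φ₂ ξ = R) : φ₁ ξ = R := by
  have i₁ := h₁.Iic_subset hξ.le
  have i₂ := h₂.Iic_subset hξ.le
  by_contra hne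
  have hlt : φ₁ ξ < R := lt_of_le_of_ne (h₁.mapsTo i₁).2 hne
  have a1 := h₁.apply_lt_apply i₁ h₁.zero_mem hξ
    (by rw [h₁.apply_zero]; exact ⟨by linarith, by linarith⟩)
  rw [h₁.apply_zero] at a1
  have a2 := h₁.inv_lt_inv_of_half_lt h₂ hg hR a1 hlt
  rw [h₁.inv_apply i₁ ⟨by linarith, hlt⟩] at a2
  have n₂ := h₂.mem_image_of_le h₂.half_mem a1.le hlt
  have a3 := h₂.antitoneOn (h₂.inv_mem n₂) i₂ a2.le
  rw [h₂.apply_inv n₂] at a3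
  linarith

theorem lt_of_pos (h₁ : DecreasingProfile R D f g₁ c I₁ φ₁ W₁)
    (h₂ : DecreasingProfile R D f g₂ c I₂ φ₂ W₂) (hg : ∀ ρ ∈ Ioo 0 R, g₂ ρ < g₁ ρ) (hR : 0 < R)
    {ξ : ℝ} (hξ : 0 < ξ) (i₁ : ξ ∈ I₁) (i₂ : ξ ∈ I₂) (hφ : 0 < φ₁ ξ) : φ₁ ξ < φ₂ ξ := by
  by_contra! hle
  have hhalf := h₁.antitoneOn h₁.zero_mem i₁ hξ.le
  rw [h₁.apply_zero] at hhalf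
  have hm : φ₁ ξ ∈ Ioo 0 R := ⟨hφ, by linarith⟩
  have a1 := h₁.apply_lt_apply h₁.zero_mem i₁ hξ hm
  rw [h₁.apply_zero] at a1
  have n₂ := h₂.mem_image_of_le (mem_image_of_mem φ₂ i₂) hle hm.2
  have a2 := h₁.inv_lt_inv_of_lt_half h₂ hg hR (mem_image_of_mem φ₁ i₁) n₂ hφ a1
  rw [h₁.inv_apply i₁ hm] at a2
  have a3 := h₂.apply_lt_apply i₂ (h₂.inv_mem n₂) a2 (by rw [h₂.apply_inv n₂]; exact hm)
  rw [h₂.apply_inv n₂] at a3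
  linarith

end DecreasingProfile

/-! ### Wavefronts and semi-wavefronts as decreasing profiles -/

theorem IsWavefrontProfile.exists_decreasingProfile {R : ℝ} {D f g : ℝ → ℝ} {c : ℝ} {φ : ℝ → ℝ}
    (hφ : IsWavefrontProfile R D f g c R 0 φ) (hR : 0 < R) (hf : ContDiffOn ℝ 1 f (Icc 0 R))
    (hf0 : f 0 = 0) (hD : ContinuousOn D (Icc 0 R)) (hDpos : ∀ ρ ∈ Ioo 0 R, 0 < D ρ)
    (hD0 : ∀ ρ ∈ Icc 0 R, 0 ≤ D ρ) (hg : SourceMonostable R D g) (h0 : φ 0 = R / 2) :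
    ∃ W, DecreasingProfile R D f g c univ φ W := by
  obtain ⟨W, S, h⟩ := hφ.travelingWave.exists_fluxBalance hφ.classicalOrSharp (mem_univ 0)
    hf.continuousOn hg.continuousOn
  have hg0 : ∀ ρ ∈ Icc 0 R, 0 ≤ g ρ := by
    intro ρ hρ
    rcases hρ.1.eq_or_lt with e | e
    · rw [← e, hg.zero_left]
    rcases hρ.2.eq_or_lt with e' | e'
    · rw [e', hg.zero_right]
    exact (hg.pos ρ ⟨e, e'⟩).le
  have hfd := hf.differentiableOn one_ne_zero
  exact ⟨W, h.decreasingProfile hR hfd hD hDpos hD0 hg.pos hg0 (subset_univ _)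
    ((h.antitone_of_tendsto hR hfd hf0 hD hDpos hD0 hg.pos hg0 hφ.tendsto_left
      hφ.tendsto_right).antitoneOn _) hφ.tendsto_left h0⟩

theorem IsSemiWavefrontProfileFrom.exists_decreasingProfile {R : ℝ} {D f g : ℝ → ℝ} {c w : ℝ}
    {φ : ℝ → ℝ} (hφ : IsSemiWavefrontProfileFrom R D f g c R w φ) (hR : 0 < R) (hw : 0 < w)
    (hf : ContDiffOn ℝ 1 f (Icc 0 R)) (hf0 : f 0 = 0) (hD : ContinuousOn D (Icc 0 R))
    (hDpos : ∀ ρ ∈ Ioo 0 R, 0 < D ρ) (hD0 : ∀ ρ ∈ Icc 0 R, 0 ≤ D ρ) (hg : SourcePositive R g)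
    (h0 : φ 0 = R / 2) :
    ∃ W, DecreasingProfile R D f g c (Iio w) φ W ∧ ∀ ξ < w, 0 < φ ξ := by
  obtain ⟨W, S, h⟩ := hφ.travelingWave.exists_fluxBalance hφ.classicalOrSharp hw
    hf.continuousOn hg.continuousOn
  have hg0 : ∀ ρ ∈ Icc 0 R, 0 ≤ g ρ := by
    intro ρ hρ
    rcases hρ.2.eq_or_lt with e' | e'
    · rw [e', hg.zero]
    exact (hg.pos ρ ⟨hρ.1, e'⟩).le
  have hfd := hf.differentiableOn one_ne_zero
  have hanti : AntitoneOn φ (Iio w) := by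
    refine hφ.monotonic.resolve_left fun hmono => ?_
    obtain ⟨a, ha1, ha2⟩ := ((hφ.tendsto_left.eventually_const_lt
      (by linarith : R / 2 < R)).and (eventually_le_atBot 0)).exists
    have := hmono (lt_of_le_of_lt ha2 hw : a ∈ Iio w) (hw : (0 : ℝ) ∈ Iio w) ha2
    linarith
  refine ⟨W, h.decreasingProfile hR hfd hD hDpos hD0 (fun ρ hρ => hg.pos ρ ⟨hρ.1.le, hρ.2⟩) hg0
    (fun ξ hξ => lt_of_le_of_lt hξ hw) hanti hφ.tendsto_left h0, fun ξ hξ => ?_⟩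
  -- After reaching `0` the profile would stay there with zero flux, so `W` would be constant and `g
  -- 0 = 0`, against positivity of the source at `0`.
  refine lt_of_le_of_ne (h.mapsTo hξ).1 fun e => ?_
  obtain ⟨b, hb1, hb2⟩ := exists_between hξ
  have hzero : ∀ t, ξ ≤ t → t < w → φ t = 0 := fun t ht htw =>
    le_antisymm (e ▸ hanti hξ htw ht) (h.mapsTo htw).1
  have hWzero : ∀ t, ξ ≤ t → t < w → W t = 0 := fun t ht htw => by
    have h1 := h.flux_eq_zero hf.continuousOn hD0 htw (Or.inl (hzero t ht htw))
    rw [hzero t ht htw, hf0] at h1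
    linarith
  obtain ⟨y, hy⟩ := exists_between hb1
  have h2 := h.source_eq_zero_of_eq hg0 hξ hb2
    (by rw [hWzero ξ le_rfl hξ, hWzero b hb1.le hb2]) hy
  rw [hzero y hy.1.le (hy.2.trans hb2)] at h2
  exact (hg.pos 0 ⟨le_rfl, hR⟩).ne' h2

theorem mainTheorem8 (R : ℝ) (hR : 0 < R) (f D : ℝ → ℝ) (g : ℕ → ℝ → ℝ) (c : ℝ)
    (hf : ContDiffOn ℝ 1 f (Icc 0 R)) (hf0 : f 0 = 0)
    (hD : DiffusivityHat R D ∨ ∀ n, DiffusivityTilde R D (g n))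
    (hg0 : SourceMonostable R D (g 0))
    (hg : ∀ n, 1 ≤ n → SourcePositive R (g n))
    (hdec : ∀ m n, 1 ≤ m → m < n → ∀ ρ ∈ Icc 0 R, g n ρ ≤ g m ρ)
    (hlim : TendstoUniformlyOn g (g 0) atTop (Icc 0 R))
    (φ : ℕ → ℝ → ℝ) (w : ℕ → ℝ)
    (hφ0 : IsWavefrontProfile R D f (g 0) c R 0 (φ 0))
    (hw : ∀ n, 1 ≤ n → 0 < w n)
    (hφ : ∀ n, 1 ≤ n → IsSemiWavefrontProfileFrom R D f (g n) c R (w n) (φ n))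
    (hnorm : ∀ n, φ n 0 = R / 2) :
    (∀ n, 1 ≤ n → (∀ ρ ∈ Ioo 0 R, g 0 ρ < g n ρ) →
      (∀ ξ < 0, (φ 0 ξ < R → φ 0 ξ < φ n ξ) ∧ (φ 0 ξ = R → φ n ξ = R)) ∧
      (∀ ξ ∈ Ioo 0 (w n), φ n ξ < φ 0 ξ)) ∧
    ((∀ m n, 1 ≤ m → m < n → ∀ ρ ∈ Ioo 0 R, g n ρ < g m ρ) →
      (∀ ξ < 0, ∀ m n, 1 ≤ m → m < n →
        φ n ξ ≤ φ m ξ ∧ (φ n ξ < R → φ n ξ < φ m ξ)) ∧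
      (∀ a, (∀ n, 1 ≤ n → a < w n) → ∀ ξ ∈ Icc 0 a, ∀ m n, 1 ≤ m → m < n →
        φ m ξ ≤ φ n ξ ∧ (0 < ξ → φ m ξ < φ n ξ))) := by
  have hDc : ContinuousOn D (Icc 0 R) :=
    hD.elim (fun h => h.contDiffOn.continuousOn) fun h => (h 0).continuousOn
  have hDpos : ∀ ρ ∈ Ioo 0 R, 0 < D ρ := hD.elim (fun h => h.pos) fun h => (h 0).pos
  have hD0 : ∀ ρ ∈ Icc 0 R, 0 ≤ D ρ := by
    rw [← closure_Ioo hR.ne] at hDc ⊢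
    intro ρ hρ
    exact le_on_closure (fun x hx => (hDpos x hx).le) continuousOn_const hDc hρ
  obtain ⟨W₀, h₀⟩ := hφ0.exists_decreasingProfile hR hf hf0 hDc hDpos hD0 hg0 (hnorm 0)
  have hsemi := fun n hn => (hφ n hn).exists_decreasingProfile hR (hw n hn) hf hf0 hDc hDpos hD0
    (hg n hn) (hnorm n)
  refine ⟨fun n hn hgn => ?_, fun hgs => ⟨fun ξ hξ m n hm hmn => ?_,
    fun a ha ξ hξ m n hm hmn => ?_⟩⟩
  · obtain ⟨W, h, hpos⟩ := hsemi n hn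
    exact ⟨fun ξ hξ => ⟨h.lt_of_neg h₀ hgn hR hξ, h.eq_of_neg h₀ hgn hR hξ⟩,
      fun ξ hξ => h.lt_of_pos h₀ hgn hR hξ.1 hξ.2 (mem_univ ξ) (hpos ξ hξ.2)⟩
  · obtain ⟨Wm, h, -⟩ := hsemi m hm
    obtain ⟨Wn, h', -⟩ := hsemi n (hm.trans hmn.le)
    have hlt := h.lt_of_neg h' (hgs m n hm hmn) hR hξ
    refine ⟨?_, hlt⟩
    rcases (h'.mapsTo (h'.Iic_subset hξ.le)).2.eq_or_lt with e | e
    · rw [e, h.eq_of_neg h' (hgs m n hm hmn) hR hξ e]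
    · exact (hlt e).le
  · obtain ⟨Wm, h, hpos⟩ := hsemi m hm
    obtain ⟨Wn, h', -⟩ := hsemi n (hm.trans hmn.le)
    have hξm : ξ < w m := hξ.2.trans_lt (ha m hm)
    have hlt : 0 < ξ → φ m ξ < φ n ξ := fun h0 => h.lt_of_pos h' (hgs m n hm hmn) hR h0 hξm
      (hξ.2.trans_lt (ha n (hm.trans hmn.le))) (hpos ξ hξm)
    refine ⟨?_, hlt⟩
    rcases hξ.1.eq_or_lt with e | e
    · rw [← e, hnorm, hnorm]
    · exact (hlt e).le
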